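/- For an integer $N \ge 0$ identify a vector $(a_1,\dots,a_N) \in \mathbf{R}^N$ with the monic real polynomial $P(x) = x^N + a_1 x^{N-1} + \dots + a_N$ (with $a_0 = 1$), and let $dV = da_1 \cdots da_N$ be Lebesgue measure. Let $\Omega_N \subset \mathbf{R}^N$ be the set of those $P$ all of whose complex roots have absolute value at most $1$. Let $\Omega^P_N \subset \Omega_N$ be the subset of those $P$ that have a unique largest root, i.e. a simple root $\alpha \in \mathbf{C}$ whose absolute value is strictly larger than that of every other complex root of $P$. Put $$C_N(\alpha,T) = \int_{\Omega_N} |a_N|^{\alpha-1}\, P(T)\, dV \qquad\text{(with } 0^0 = 1\text{)},$$ and $$D_{N} = \prod_{k=0}^{m-1} \left(\frac{k!^2\, 2^{2k+1}}{(2k+1)!}\right)^2 \ \text{ if } N = 2m, \qquad D_{N} = \frac{m!^2\, 2^{2m+1}}{(2m+1)!} \prod_{k=0}^{m-1} \left(\frac{k!^2\, 2^{2k+1}}{(2k+1)!}\right)^2 \ \text{ if } N = 2m+1.$$ Then for every integer $N \ge 1$ the set $\Omega^P_N$ is measurable and $$\mathrm{Vol}(\Omega^P_{N}) = \frac{4}{N(N+1)}\,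 C_{N-1}(1,1) = \begin{cases} D_N/N, & N \text{ odd}, \\ D_N/(N+1), & N \text{ even}. \end{cases}$$ -/

import Mathlib

open MeasureTheory Polynomial
open scoped Nat

noncomputable section

/-- The monic polynomial `x^N + a₁ x^(N-1) + ⋯ + a_N` of degree `N`; the coordinate `a i` of the
vector `a` is the coefficient `a_{i+1}`. -/
def monicPoly {N : ℕ} (a : Fin N → ℝ) : ℝ[X] :=
  X ^ N + ∑ i : Fin N, C (a i) * X ^ (N - 1 - (i : ℕ))

/-- The region `Ω_N` in `ℝ^N` of monic real polynomials of degree `N` all of whose complex roots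
have absolute value at most `1`. -/
def rootRegion (N : ℕ) : Set (Fin N → ℝ) :=
  {a | ∀ z : ℂ, aeval z (monicPoly a) = 0 → ‖z‖ ≤ 1}

/-- A real polynomial is Perron if it has a unique largest root in absolute value: its multiset of
complex roots, listed with multiplicity, consists of a root `α` and of further roots whose absolute
values are all strictly smaller than that of `α`. -/
def IsPerronPoly (P : ℝ[X]) : Prop :=
  ∃ (α : ℂ) (s : Multiset ℂ), P.aroots ℂ = α ::ₘ s ∧ ∀ β ∈ s, ‖β‖ < ‖α‖

/-- The Perron region `Ω^P_N`: the polynomials in `Ω_N` with a unique largest root. -/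
def perronRegion (N : ℕ) : Set (Fin N → ℝ) :=
  {a | a ∈ rootRegion N ∧ IsPerronPoly (monicPoly a)}

/-- The integral `C_N(α, T)` of `|a_N|^(α-1) P(T)` over `Ω_N` with respect to Lebesgue measure in
the coefficients, where `a_N` is the constant coefficient of `P` (so `a_0 = 1` for `N = 0`). -/
def selbergC (N : ℕ) (α T : ℝ) : ℝ :=
  ∫ a in rootRegion N, |(monicPoly a).coeff 0| ^ (α - 1) * (monicPoly a).eval T

/-- The factor `k!² 2^(2k+1) / (2k+1)!`. -/
def factorD (k : ℕ) : ℝ :=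
  (k ! : ℝ) ^ 2 * 2 ^ (2 * k + 1) / ((2 * k + 1)! : ℝ)

/-- The constant `D_N`, with `m = N / 2` rounded down: the product over `k < m` of the squares of
the factors, multiplied by the factor with index `m` when `N = 2m + 1` is odd. -/
def constD (N : ℕ) : ℝ :=
  if Even N then ∏ k ∈ Finset.range (N / 2), factorD k ^ 2
  else factorD (N / 2) * ∏ k ∈ Finset.range (N / 2), factorD k ^ 2

end

/-! Two changes of variables prove the theorem.

A unique largest root is real, because its conjugate is a root of the same absolute value. So a
Perron polynomial of degree `N + 1` is uniquely `(x - r) Q` with `|r| ≤ 1` and all roots of `Q`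
smaller than `|r|`. The passage from `(r, Q)` to the coefficients has Jacobian `|Q(r)|`
(`volume_perronRegion_succ`). Scaling the roots of `Q` by `1 / r` separates the integral into a
power of `|r|`, whose integral is `4 / ((N + 1)(N + 2))`, and the integral of `|Q(1)|` over
polynomials with roots in the open disc (`volume_perronRegion_succ_eq`).

The latter is computed by the Schur–Cohn recursion. For `|k| < 1`, a polynomial with constant
coefficient `k` is uniquely `x Q + k Q*`, with `Q*` the reversal of `Q`, and it has its roots in the
disc iff `Q` does (`IsExterior.snoc_schurStep_mem_iff`). At fixed `k` this is linear in `Q` with an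
explicit determinant, and the value at 1 is multiplied by `1 + k`. Hence the integral is a product
of one-dimensional beta integrals (`IsExterior.evalOneIntegral_eq`), which telescopes to `constD`.
-/

/-! ### Coefficient vectors and monic polynomials -/

theorem aeval_monicPoly {A : Type*} [CommRing A] [Algebra ℝ A] {N : ℕ} (a : Fin N → ℝ) (z : A) :
    aeval z (monicPoly a) = z ^ N + ∑ i : Fin N, algebraMap ℝ A (a i) * z ^ (N - 1 - (i : ℕ)) := by
  simp [monicPoly]

theorem monicPoly_snoc {N : ℕ} (a : Fin N → ℝ) (c : ℝ) :
    monicPoly (Fin.snoc a c : Fin (N + 1) → ℝ) = X * monicPoly a + C c := by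
  simp only [monicPoly, Fin.sum_univ_castSucc, Fin.snoc_castSucc, Fin.snoc_last, Fin.val_castSucc,
    Fin.val_last, mul_add, Finset.mul_sum, pow_succ']
  simp only [Nat.add_sub_cancel, Nat.sub_self, pow_zero, mul_one, add_assoc]
  congr 2
  refine Finset.sum_congr rfl fun i _ => ?_
  have h : N - (i : ℕ) = (N - 1 - i) + 1 := by have := i.2; omega
  rw [h, pow_succ]
  ring

theorem monic_natDegree_monicPoly : ∀ {N : ℕ} (a : Fin N → ℝ),
    (monicPoly a).Monic ∧ (monicPoly a).natDegree = N
  | 0, a => by simp [monicPoly]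
  | N + 1, a => by
    obtain ⟨h, h'⟩ := monic_natDegree_monicPoly (Fin.init a)
    rw [← Fin.snoc_init_self a, monicPoly_snoc]
    have hX : (X * monicPoly (Fin.init a)).Monic := monic_X.mul h
    have hd : (X * monicPoly (Fin.init a)).natDegree = N + 1 := by
      rw [monic_X.natDegree_mul h, natDegree_X, h', add_comm]
    refine ⟨hX.add_of_left ?_, by rw [natDegree_add_C, hd]⟩
    rw [degree_eq_natDegree hX.ne_zero, hd]
    exact lt_of_le_of_lt degree_C_le (by exact_mod_cast Nat.succ_pos N)

theorem monic_monicPoly {N : ℕ} (a : Fin N → ℝ) : (monicPoly a).Monic :=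
  (monic_natDegree_monicPoly a).1

theorem natDegree_monicPoly {N : ℕ} (a : Fin N → ℝ) : (monicPoly a).natDegree = N :=
  (monic_natDegree_monicPoly a).2

theorem exists_monicPoly_eq : ∀ {N : ℕ} {Q : ℝ[X]}, Q.Monic → Q.natDegree = N →
    ∃ a : Fin N → ℝ, monicPoly a = Q
  | 0, Q, h, h' => ⟨0, by
      rw [h.natDegree_eq_zero.1 h']; simp [monicPoly]⟩
  | N + 1, Q, h, h' => by
    have hd : Q.divX.natDegree = N := by rw [natDegree_divX_eq_natDegree_tsub_one, h']; rfl
    have hm : Q.divX.Monic := by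
      rw [Monic, leadingCoeff, hd, coeff_divX, ← h']; exact h
    obtain ⟨a, ha⟩ := exists_monicPoly_eq hm hd
    exact ⟨Fin.snoc a (Q.coeff 0), by rw [monicPoly_snoc, ha, X_mul_divX_add]⟩

theorem monicPoly_injective : ∀ {N : ℕ}, Function.Injective (monicPoly (N := N))
  | 0 => fun _ _ _ => Subsingleton.elim _ _
  | N + 1 => fun a b h => by
    rw [← Fin.snoc_init_self a, ← Fin.snoc_init_self b, monicPoly_snoc, monicPoly_snoc] at h
    have h0 : a (Fin.last N) = b (Fin.last N) := by
      simpa using congrArg (fun P => P.coeff 0) h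
    have h1 : monicPoly (Fin.init a) = monicPoly (Fin.init b) := by
      rw [h0] at h
      exact mul_left_cancel₀ X_ne_zero (add_right_cancel h)
    rw [← Fin.snoc_init_self a, ← Fin.snoc_init_self b, h0, monicPoly_injective h1]

/-- The vector of coefficients of `(x - r) Q(x)`, where `Q = monicPoly q`. -/
def mulRoot {N : ℕ} (r : ℝ) (q : Fin N → ℝ) : Fin (N + 1) → ℝ := fun i =>
  (Fin.snoc q 0 : Fin (N + 1) → ℝ) i - r * (Fin.cons 1 q : Fin (N + 1) → ℝ) i

theorem monicPoly_mulRoot {N : ℕ} (r : ℝ) (q : Fin N → ℝ) :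
    monicPoly (mulRoot r q) = (X - C r) * monicPoly q := by
  have h1 : X * monicPoly q = monicPoly (Fin.snoc q 0 : Fin (N + 1) → ℝ) := by
    simp [monicPoly_snoc]
  have h2 : monicPoly q = ∑ i : Fin (N + 1),
      C ((Fin.cons 1 q : Fin (N + 1) → ℝ) i) * X ^ (N + 1 - 1 - (i : ℕ)) := by
    rw [Fin.sum_univ_succ]
    simp [monicPoly, Nat.sub_sub, add_comm]
  rw [sub_mul, h1, h2]
  rw [monicPoly, monicPoly, add_sub_assoc, Finset.mul_sum, ← Finset.sum_sub_distrib]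
  congr 1
  refine Finset.sum_congr rfl fun i _ => ?_
  simp only [mulRoot, C_sub, C_mul]
  ring

/-! ### The Schur–Cohn recursion and root location -/

/-- The step `a ↦ a + k · (reversal of a)` of the Schur–Cohn (Levinson) recursion. -/
def schurStep {N : ℕ} (k : ℝ) : (Fin N → ℝ) →ₗ[ℝ] (Fin N → ℝ) where
  toFun a i := a i + k * a i.rev
  map_add' a b := by ext i; simp; ring
  map_smul' c a := by ext i; simp; ring

theorem schurStep_apply {N : ℕ} (k : ℝ) (a : Fin N → ℝ) (i : Fin N) :
    schurStep k a i = a i + k * a i.rev := rfl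

/-- Away from 0 the reversal of `Q` is `z ^ N * Q(1/z)`, so the new polynomial is `x Q + k Q*`. The
leading 1 of `Q` becomes the constant term of `Q*` and yields the last coefficient `k`. -/
theorem aeval_schurStep {A : Type*} [Field A] [Algebra ℝ A] {N : ℕ} (a : Fin N → ℝ) (k : ℝ)
    {z : A} (hz : z ≠ 0) :
    aeval z (monicPoly (Fin.snoc (schurStep k a) k : Fin (N + 1) → ℝ)) =
      z * aeval z (monicPoly a) + algebraMap ℝ A k * (z ^ N * aeval z⁻¹ (monicPoly a)) := by
  have h1 : z ^ N * aeval z⁻¹ (monicPoly a) =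
      1 + z * ∑ i : Fin N, algebraMap ℝ A (a i.rev) * z ^ (N - 1 - (i : ℕ)) := by
    rw [aeval_monicPoly, mul_add, ← mul_pow, mul_inv_cancel₀ hz, one_pow, Finset.mul_sum,
      Finset.mul_sum, ← Equiv.sum_comp Fin.revPerm]
    congr 1
    refine Finset.sum_congr rfl fun i _ => ?_
    have h : N = (N - 1 - i) + 1 + i := by have := i.2; omega
    have h' : N - 1 - (i.rev : ℕ) = i := by have := i.2; rw [Fin.val_rev]; omega
    have h'' : z ^ N = z ^ (N - 1 - (i : ℕ)) * z * z ^ (i : ℕ) := by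
      conv_lhs => rw [h]
      rw [pow_add, pow_succ]
    rw [Fin.revPerm_apply, h', h'', inv_pow]
    field_simp
  rw [h1, monicPoly_snoc, map_add, map_mul, aeval_X, aeval_C, aeval_monicPoly, aeval_monicPoly]
  simp only [schurStep_apply, map_add, map_mul, add_mul, Finset.sum_add_distrib, Finset.mul_sum,
    mul_add, mul_one, ← add_assoc]
  rw [add_right_comm]
  congr 1
  refine Finset.sum_congr rfl fun i _ => ?_
  ring

theorem schurStep_schurStep_neg {N : ℕ} (k : ℝ) (a : Fin N → ℝ) :
    schurStep k (schurStep (-k) a) = (1 - k ^ 2) • a := by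
  ext i
  simp only [schurStep_apply, Fin.rev_rev, Pi.smul_apply, smul_eq_mul]
  ring

theorem schurStep_bijective {N : ℕ} {k : ℝ} (hk : |k| < 1) :
    Function.Bijective (schurStep (N := N) k) := by
  have h0 : 1 - k ^ 2 ≠ 0 := by
    have := (sq_lt_one_iff_abs_lt_one k).2 hk
    linarith
  have hs : Function.Surjective (schurStep (N := N) k) := fun b =>
    ⟨(1 - k ^ 2)⁻¹ • schurStep (-k) b, by
      rw [map_smul, schurStep_schurStep_neg, smul_smul, inv_mul_cancel₀ h0, one_smul]⟩
  exact ⟨LinearMap.injective_iff_surjective.2 hs, hs⟩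

/-- Holds factor by factor: `|z - w|² - |1 - w z̄|² = (|z|² - 1)(1 - |w|²) ≥ 0`. -/
theorem norm_prod_one_sub_mul_le {z : ℂ} (hz : 1 ≤ ‖z‖) (s : Multiset ℂ) :
    (∀ w ∈ s, ‖w‖ ≤ 1) →
    ‖(s.map fun w => 1 - w * (starRingEnd ℂ) z).prod‖ ≤ ‖(s.map fun w => z - w).prod‖ := by
  induction s using Multiset.induction with
  | empty => simp
  | cons w s ih =>
    intro h
    simp only [Multiset.map_cons, Multiset.prod_cons, norm_mul]
    refine mul_le_mul ?_ (ih fun v hv => h v (Multiset.mem_cons_of_mem hv)) (norm_nonneg _)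
      (norm_nonneg _)
    have hw := h w (Multiset.mem_cons_self w s)
    have h1 : ‖z - w‖ ^ 2 - ‖1 - w * (starRingEnd ℂ) z‖ ^ 2 = (‖z‖ ^ 2 - 1) * (1 - ‖w‖ ^ 2) := by
      simp only [Complex.sq_norm, Complex.normSq_apply]
      simp
      ring
    have h2 : 0 ≤ (‖z‖ ^ 2 - 1) * (1 - ‖w‖ ^ 2) :=
      mul_nonneg (by nlinarith) (by nlinarith [norm_nonneg w])
    exact (sq_le_sq₀ (norm_nonneg _) (norm_nonneg _)).1 (by linarith)

theorem aeval_eq_prod_aroots_sub {P : ℝ[X]} (hP : P.Monic) (z : ℂ) :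
    aeval z P = ((P.aroots ℂ).map fun w => z - w).prod :=
  (IsAlgClosed.splits _).aeval_eq_prod_aroots_of_monic hP z

theorem card_aroots_complex (P : ℝ[X]) : (P.aroots ℂ).card = P.natDegree := by
  rw [aroots, splits_iff_card_roots.1 (IsAlgClosed.splits _), natDegree_map]

theorem pow_card_mul_prod_inv_sub {c : ℂ} (hc : c ≠ 0) (s : Multiset ℂ) :
    c ^ s.card * (s.map fun w => c⁻¹ - w).prod = (s.map fun w => 1 - w * c).prod := by
  induction s using Multiset.induction with
  | empty => simp
  | cons w s ih =>
    rw [Multiset.card_cons, Multiset.map_cons, Multiset.prod_cons, Multiset.map_cons,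
      Multiset.prod_cons, ← ih, pow_succ]
    field_simp

/-- If all roots of a monic real polynomial lie in the closed unit disc, it dominates its
reversal outside the open unit disc. -/
theorem norm_reverse_le {P : ℝ[X]} (hP : P.Monic) (h : ∀ z : ℂ, aeval z P = 0 → ‖z‖ ≤ 1) {z : ℂ}
    (hz : 1 ≤ ‖z‖) : ‖z ^ P.natDegree * aeval z⁻¹ P‖ ≤ ‖aeval z P‖ := by
  have hz0 : (starRingEnd ℂ) z ≠ 0 := by
    rw [Ne, map_eq_zero]; rintro rfl; simp at hz; linarith
  -- Real coefficients let conjugation pass to the argument, so that the factors match those of the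
  -- product bound.
  have h1 : (starRingEnd ℂ) (z ^ P.natDegree * aeval z⁻¹ P) =
      ((P.aroots ℂ).map fun w => 1 - w * (starRingEnd ℂ) z).prod := by
    rw [map_mul, ← aeval_conj, map_inv₀, map_pow, aeval_eq_prod_aroots_sub hP,
      ← card_aroots_complex, pow_card_mul_prod_inv_sub hz0]
  rw [← RCLike.norm_conj, h1, aeval_eq_prod_aroots_sub hP]
  exact norm_prod_one_sub_mul_le hz _ fun w hw => h w (mem_aroots'.1 hw).2

/-- The vectors whose monic polynomial has no complex root in `E`. -/
def avoidRegion (E : Set ℂ) (N : ℕ) : Set (Fin N → ℝ) :=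
  {a | ∀ z : ℂ, aeval z (monicPoly a) = 0 → z ∉ E}

theorem rootRegion_eq_avoidRegion (N : ℕ) : rootRegion N = avoidRegion {z | 1 < ‖z‖} N := by
  ext a; simp [rootRegion, avoidRegion]

/-- `E` lies between the exteriors of the closed and of the open unit disc. -/
structure IsExterior (E : Set ℂ) : Prop where
  mem_of_one_lt : ∀ z : ℂ, 1 < ‖z‖ → z ∈ E
  one_le_of_mem : ∀ z ∈ E, 1 ≤ ‖z‖

/-- Both choices of `E` are needed: `rootRegion` allows roots on the unit circle, while the rescaled
cofactor of a Perron root has none. Running the recursion for each gives the same value, so the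
boundary need not be shown to be null. -/
theorem isExterior_one_lt : IsExterior {z | 1 < ‖z‖} :=
  ⟨fun _ h => h, fun _ h => le_of_lt h⟩

theorem isExterior_one_le : IsExterior {z | 1 ≤ ‖z‖} :=
  ⟨fun _ h => le_of_lt h, fun _ h => h⟩

theorem IsExterior.norm_le_one {E : Set ℂ} (hE : IsExterior E) {N : ℕ} {a : Fin N → ℝ}
    (ha : a ∈ avoidRegion E N) {z : ℂ} (hz : aeval z (monicPoly a) = 0) : ‖z‖ ≤ 1 :=
  not_lt.1 fun h => ha z hz (hE.mem_of_one_lt z h)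

/-- The Schur–Cohn criterion. -/
theorem IsExterior.snoc_schurStep_mem_iff {E : Set ℂ} (hE : IsExterior E) {N : ℕ}
    (a : Fin N → ℝ) {k : ℝ} (hk : |k| < 1) :
    (Fin.snoc (schurStep k a) k : Fin (N + 1) → ℝ) ∈ avoidRegion E (N + 1) ↔
      a ∈ avoidRegion E N := by
  constructor
  · intro h z hz hzE
    have hz1 := hE.one_le_of_mem z hzE
    have hz0 : z ≠ 0 := by rintro rfl; simp at hz1; linarith
    -- At a root `z` of `Q`, `P(z) = k Q*(z)` while the reversal of `P` takes the value `Q*(z)`.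
    -- Domination gives `|Q*(z)| ≤ |k| |Q*(z)|`, impossible as `P(z) ≠ 0`.
    have h1 := norm_reverse_le (monic_monicPoly _) (fun _ => hE.norm_le_one h) hz1
    have h2 := aeval_schurStep a k hz0
    have h3 := aeval_schurStep a k (inv_ne_zero hz0)
    have hne : aeval z (monicPoly (Fin.snoc (schurStep k a) k : Fin (N + 1) → ℝ)) ≠ 0 :=
      fun h0 => h z h0 hzE
    rw [inv_inv, hz, mul_zero, mul_zero, add_zero] at h3
    rw [hz, mul_zero, zero_add] at h2
    rw [natDegree_monicPoly, h3, pow_succ, mul_assoc, mul_inv_cancel_left₀ hz0] at h1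
    rw [h2, norm_mul (algebraMap ℝ ℂ k), Complex.coe_algebraMap, Complex.norm_real,
      Real.norm_eq_abs] at h1
    rw [h2] at hne
    have h4 := norm_pos_iff.2 (right_ne_zero_of_mul hne)
    nlinarith
  · intro h z hz hzE
    have hz1 := hE.one_le_of_mem z hzE
    have hz0 : z ≠ 0 := by rintro rfl; simp at hz1; linarith
    -- At a root `z` of `P`, `|z| |Q(z)| = |k| |Q*(z)| ≤ |k| |Q(z)|`, against `|k| < 1 ≤ |z|`.
    have h1 := norm_reverse_le (monic_monicPoly _) (fun _ => hE.norm_le_one h) hz1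
    have hne : aeval z (monicPoly a) ≠ 0 := fun h0 => h z h0 hzE
    rw [aeval_schurStep a k hz0, add_eq_zero_iff_eq_neg] at hz
    have h2 := congrArg norm hz
    rw [natDegree_monicPoly] at h1
    rw [norm_neg, norm_mul, norm_mul, Complex.coe_algebraMap, Complex.norm_real,
      Real.norm_eq_abs] at h2
    have h4 := norm_pos_iff.2 hne
    have h5 : |k| * ‖z ^ N * aeval z⁻¹ (monicPoly a)‖ ≤ |k| * ‖aeval z (monicPoly a)‖ :=
      mul_le_mul_of_nonneg_left h1 (abs_nonneg k)
    nlinarith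

theorem Multiset.norm_prod_le_one {s : Multiset ℂ} : (∀ w ∈ s, ‖w‖ ≤ 1) → ‖s.prod‖ ≤ 1 := by
  induction s using Multiset.induction with
  | empty => simp
  | cons w s ih =>
    intro h
    rw [Multiset.prod_cons, norm_mul]
    exact mul_le_one₀ (h w (Multiset.mem_cons_self w s)) (norm_nonneg _)
      (ih fun v hv => h v (Multiset.mem_cons_of_mem hv))

/-- Up to sign the constant coefficient is the product of the roots. -/
theorem IsExterior.abs_last_le_one {E : Set ℂ} (hE : IsExterior E) {N : ℕ} {b : Fin N → ℝ} {k : ℝ}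
    (h : (Fin.snoc b k : Fin (N + 1) → ℝ) ∈ avoidRegion E (N + 1)) : |k| ≤ 1 := by
  have h1 := aeval_eq_prod_aroots_sub (monic_monicPoly (Fin.snoc b k : Fin (N + 1) → ℝ)) 0
  have h2 : aeval (0 : ℂ) (monicPoly (Fin.snoc b k : Fin (N + 1) → ℝ)) = k := by
    simp [monicPoly_snoc]
  rw [← Real.norm_eq_abs, ← Complex.norm_real, ← h2, h1]
  refine Multiset.norm_prod_le_one fun w hw => ?_
  obtain ⟨v, hv, rfl⟩ := Multiset.mem_map.1 hw
  simpa using hE.norm_le_one h (mem_aroots'.1 hv).2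

theorem IsExterior.preimage_snoc_eq {E : Set ℂ} (hE : IsExterior E) (N : ℕ) {k : ℝ}
    (hk : |k| < 1) :
    {b : Fin N → ℝ | (Fin.snoc b k : Fin (N + 1) → ℝ) ∈ avoidRegion E (N + 1)} =
      schurStep k '' avoidRegion E N := by
  ext b
  obtain ⟨a, rfl⟩ := (schurStep_bijective hk).2 b
  rw [Set.mem_ofPred_eq, hE.snoc_schurStep_mem_iff a hk,
    (schurStep_bijective hk).1.mem_set_image]

/-! ### The determinant of the recursion step -/

/-- The matrix of `schurStep k`. -/
noncomputable def schurMatrix (N : ℕ) (k : ℝ) : Matrix (Fin N) (Fin N) ℝ :=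
  Matrix.of fun i j => (if i = j then 1 else 0) + k * if i.rev = j then 1 else 0

theorem schurStep_eq_toLin' (N : ℕ) (k : ℝ) : schurStep k = Matrix.toLin' (schurMatrix N k) := by
  ext1 a
  ext i
  simp [schurStep_apply, schurMatrix, Matrix.mulVec, dotProduct, add_mul, Finset.sum_add_distrib]

/-- Splitting off the first and the last index. -/
noncomputable def finOuterEquiv (N : ℕ) : Fin N ⊕ Fin 2 ≃ Fin (N + 2) :=
  Equiv.ofBijective (Sum.elim (fun i => i.castSucc.succ) ![0, Fin.last (N + 1)]) <| by
    rw [Fintype.bijective_iff_injective_and_card]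
    refine ⟨?_, by simp⟩
    rintro (i | i) (j | j) h
    · simpa [Fin.ext_iff] using h
    · have := i.2
      fin_cases j <;> simp [Fin.ext_iff] at h
      omega
    · have := j.2
      fin_cases i <;> simp [Fin.ext_iff] at h
      omega
    · fin_cases i <;> fin_cases j <;> simp [Fin.ext_iff] at h ⊢

/-- Reversal swaps the two outer indices, which split off as the block `!![1, k; k, 1]`. For odd
size the middle index is fixed and finally contributes `1 + k`. -/
theorem det_schurMatrix_add_two (N : ℕ) (k : ℝ) :
    (schurMatrix (N + 2) k).det = (schurMatrix N k).det * (1 - k ^ 2) := by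
  have h : (schurMatrix (N + 2) k).submatrix (finOuterEquiv N) (finOuterEquiv N) =
      Matrix.fromBlocks (schurMatrix N k) 0 0 !![1, k; k, 1] := by
    ext (i | i) (j | j)
    · have := i.2
      have := j.2
      simp only [schurMatrix, finOuterEquiv, Fin.ext_iff, Matrix.submatrix_apply, Matrix.of_apply,
        Equiv.ofBijective_apply, Sum.elim_inl, Matrix.fromBlocks_apply₁₁, Fin.val_rev,
        Fin.val_succ, Fin.val_castSucc]
      have h1 : (i : ℕ) + 1 = j + 1 ↔ (i : ℕ) = j := by omega
      have h2 : N + 2 - ((i : ℕ) + 1 + 1) = j + 1 ↔ N - ((i : ℕ) + 1) = j := by omega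
      simp only [h1, h2]
    · have := i.2
      fin_cases j <;> simp [schurMatrix, finOuterEquiv, Fin.ext_iff, Fin.val_rev] <;> grind
    · have := j.2
      fin_cases i <;> simp [schurMatrix, finOuterEquiv, Fin.ext_iff, Fin.val_rev] <;> grind
    · fin_cases i <;> fin_cases j <;> simp [schurMatrix, finOuterEquiv, Fin.ext_iff]
  rw [← Matrix.det_submatrix_equiv_self (finOuterEquiv N), h, Matrix.det_fromBlocks_zero₁₂,
    Matrix.det_fin_two_of]
  ring

theorem det_schurMatrix : ∀ (N : ℕ) (k : ℝ),
    (schurMatrix N k).det = (1 - k ^ 2) ^ (N / 2) * (1 + k) ^ (N % 2)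
  | 0, k => by simp
  | 1, k => by simp [schurMatrix]
  | N + 2, k => by
    rw [det_schurMatrix_add_two, det_schurMatrix N k, Nat.add_mod_right,
      Nat.add_div_right N (by norm_num), pow_succ]
    ring

/-! ### Change of variables, Tonelli and measurability -/

theorem setLIntegral_image_affine {N : ℕ} (L : (Fin N → ℝ) →ₗ[ℝ] (Fin N → ℝ)) (c : Fin N → ℝ)
    (hL : Function.Injective L) {s : Set (Fin N → ℝ)} (hs : MeasurableSet s)
    (f : (Fin N → ℝ) → ENNReal) :
    ∫⁻ x in (fun x => L x + c) '' s, f x =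
      ENNReal.ofReal |LinearMap.det L| * ∫⁻ x in s, f (L x + c) := by
  rw [lintegral_image_eq_lintegral_abs_det_fderiv_mul volume hs
    (f := fun x => L x + c) (f' := fun _ => LinearMap.toContinuousLinearMap L)
    (fun x _ => ((LinearMap.toContinuousLinearMap L).hasFDerivAt.add_const c).hasFDerivWithinAt)
    (fun x _ y _ h => hL (add_right_cancel h))]
  simp only [LinearMap.det_toContinuousLinearMap]
  rw [lintegral_const_mul' _ _ ENNReal.ofReal_ne_top]

theorem lintegral_eq_lintegral_snoc {N : ℕ} {f : (Fin (N + 1) → ℝ) → ENNReal} (hf : Measurable f) :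
    ∫⁻ a, f a = ∫⁻ k : ℝ, ∫⁻ b : Fin N → ℝ, f (Fin.snoc b k) := by
  have h := (volume_preserving_piFinSuccAbove (fun _ : Fin (N + 1) => ℝ) (Fin.last N)).symm
  rw [← h.lintegral_comp hf, Measure.volume_eq_prod,
    lintegral_prod (fun p => f ((MeasurableEquiv.piFinSuccAbove (fun _ => ℝ) (Fin.last N)).symm p))
      (hf.comp h.measurable).aemeasurable]
  simp [MeasurableEquiv.piFinSuccAbove, Fin.insertNthEquiv, Fin.insertNth_last']

theorem continuous_monicPoly_eval {N : ℕ} :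
    Continuous fun p : (Fin N → ℝ) × ℝ => (monicPoly p.1).eval p.2 := by
  simp only [monicPoly, eval_add, eval_pow, eval_X, eval_finsetSum, eval_mul, eval_C]
  fun_prop

theorem continuous_snoc {N : ℕ} :
    Continuous fun p : (Fin N → ℝ) × ℝ => (Fin.snoc p.1 p.2 : Fin (N + 1) → ℝ) := by
  refine continuous_pi fun i => ?_
  induction i using Fin.lastCases with
  | last => simpa using continuous_snd
  | cast i => simpa using by fun_prop

theorem continuous_aeval_monicPoly {N : ℕ} :
    Continuous fun p : (Fin N → ℝ) × ℂ => aeval p.2 (monicPoly p.1) := by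
  simp only [aeval_monicPoly, Complex.coe_algebraMap]
  fun_prop

/-- A closed subset of a σ-compact space is a countable union of compact sets, whose projections are
compact and hence closed. -/
theorem IsClosed.measurableSet_image_fst {α β : Type*} [TopologicalSpace α] [T2Space α]
    [MeasurableSpace α] [OpensMeasurableSpace α] [TopologicalSpace β] [SigmaCompactSpace (α × β)]
    {K : Set (α × β)} (hK : IsClosed K) : MeasurableSet (Prod.fst '' K) := by
  have h := (isSigmaCompact_univ.of_isClosed_subset hK (Set.subset_univ K)).image continuous_fst
  obtain ⟨S, hS, hU⟩ := h
  rw [← hU]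
  exact MeasurableSet.iUnion fun n => (hS n).isClosed.measurableSet

theorem measurableSet_avoidRegion_of_isClosed {E : Set ℂ} (hE : IsClosed E) (N : ℕ) :
    MeasurableSet (avoidRegion E N) := by
  have hK : IsClosed {p : (Fin N → ℝ) × ℂ | aeval p.2 (monicPoly p.1) = 0 ∧ p.2 ∈ E} :=
    (isClosed_eq continuous_aeval_monicPoly continuous_const).inter (hE.preimage continuous_snd)
  convert hK.measurableSet_image_fst.compl using 1
  ext a
  simp [avoidRegion]

theorem measurableSet_avoidRegion_one_le (N : ℕ) :
    MeasurableSet (avoidRegion {z | 1 ≤ ‖z‖} N) :=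
  measurableSet_avoidRegion_of_isClosed (isClosed_le continuous_const continuous_norm) N

theorem measurableSet_avoidRegion_one_lt (N : ℕ) :
    MeasurableSet (avoidRegion {z | 1 < ‖z‖} N) := by
  obtain ⟨F, hF, -, hU, -⟩ := (isOpen_lt (continuous_const (y := (1 : ℝ)))
    (continuous_norm (E := ℂ))).exists_iUnion_isClosed
  have h : avoidRegion {z | 1 < ‖z‖} N = ⋂ n, avoidRegion (F n) N := by
    rw [← hU]
    ext a
    simp only [avoidRegion, Set.mem_iUnion, Set.mem_iInter, Set.mem_ofPred_eq, not_exists]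
    exact ⟨fun h n z hz => h z hz n, fun h z hz n => h n z hz⟩
  rw [h]
  exact MeasurableSet.iInter fun n => measurableSet_avoidRegion_of_isClosed (hF n) N

/-! ### The integral of the value at 1 -/

/-- The integral of `|P(1)|` over the polynomials without roots in `E`. -/
noncomputable def evalOneIntegral (E : Set ℂ) (N : ℕ) : ENNReal :=
  ∫⁻ a in avoidRegion E N, ENNReal.ofReal |(monicPoly a).eval 1|

/-- The factor by which `evalOneIntegral` grows from degree `N` to degree `N + 1`. -/
noncomputable def evalOneFactor (N : ℕ) : ℝ :=
  ∫ k in (-1 : ℝ)..1, (1 + k) * ((1 - k ^ 2) ^ (N / 2) * (1 + k) ^ (N % 2))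

/-- A polynomial and its reversal agree at 1. -/
theorem eval_one_snoc_schurStep {N : ℕ} (a : Fin N → ℝ) (k : ℝ) :
    (monicPoly (Fin.snoc (schurStep k a) k : Fin (N + 1) → ℝ)).eval 1 =
      (1 + k) * (monicPoly a).eval 1 := by
  have h := aeval_schurStep a k (one_ne_zero (α := ℝ))
  simp only [coe_aeval_eq_eval, inv_one, one_pow, one_mul, Algebra.algebraMap_self,
    RingHom.id_apply] at h
  rw [h]
  ring

theorem IsExterior.lintegral_section {E : Set ℂ} (hE : IsExterior E) {N : ℕ}
    (hm : MeasurableSet (avoidRegion E N)) {k : ℝ} (hk : |k| < 1) :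
    ∫⁻ b in {b : Fin N → ℝ | (Fin.snoc b k : Fin (N + 1) → ℝ) ∈ avoidRegion E (N + 1)},
      ENNReal.ofReal |(monicPoly (Fin.snoc b k : Fin (N + 1) → ℝ)).eval 1| =
    ENNReal.ofReal ((1 + k) * ((1 - k ^ 2) ^ (N / 2) * (1 + k) ^ (N % 2))) *
      evalOneIntegral E N := by
  have hk' := abs_lt.1 hk
  have h1 : 0 < 1 + k := by linarith
  have h2 : 0 < 1 - k ^ 2 := by nlinarith
  have h3 : 0 < (1 - k ^ 2) ^ (N / 2) * (1 + k) ^ (N % 2) := by positivity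
  have h := setLIntegral_image_affine (schurStep k) 0 (schurStep_bijective hk).1 hm
    (fun b => ENNReal.ofReal |(monicPoly (Fin.snoc b k : Fin (N + 1) → ℝ)).eval 1|)
  simp only [add_zero] at h
  rw [hE.preimage_snoc_eq N hk, h, schurStep_eq_toLin', LinearMap.det_toLin', det_schurMatrix,
    ← schurStep_eq_toLin']
  simp only [eval_one_snoc_schurStep, abs_mul, abs_of_pos h1, ENNReal.ofReal_mul h1.le]
  rw [lintegral_const_mul' _ _ ENNReal.ofReal_ne_top, ← abs_mul, abs_of_pos h3, evalOneIntegral]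
  ring

theorem IsExterior.evalOneIntegral_succ {E : Set ℂ} (hE : IsExterior E)
    (hm : ∀ N, MeasurableSet (avoidRegion E N)) (N : ℕ) :
    evalOneIntegral E (N + 1) = ENNReal.ofReal (evalOneFactor N) * evalOneIntegral E N := by
  have hf : Measurable fun a : Fin (N + 1) → ℝ => ENNReal.ofReal |(monicPoly a).eval 1| := by
    have := (continuous_monicPoly_eval (N := N + 1)).comp (Continuous.prodMk_left (1 : ℝ))
    exact (continuous_abs.comp this).measurable.ennreal_ofReal
  have hI : ∀ᵐ k : ℝ, ∫⁻ b : Fin N → ℝ, (avoidRegion E (N + 1)).indicator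
      (fun a => ENNReal.ofReal |(monicPoly a).eval 1|) (Fin.snoc b k) =
      (Set.Ioc (-1 : ℝ) 1).indicator (fun k => ENNReal.ofReal
        ((1 + k) * ((1 - k ^ 2) ^ (N / 2) * (1 + k) ^ (N % 2))) * evalOneIntegral E N) k := by
    -- The criterion requires `|k| < 1`, and for `|k| > 1` the section is empty; only `k = ±1` is
    -- discarded.
    filter_upwards [Measure.ae_ne volume (1 : ℝ), Measure.ae_ne volume (-1 : ℝ)] with k h1 h2
    have hs : MeasurableSet
        {b : Fin N → ℝ | (Fin.snoc b k : Fin (N + 1) → ℝ) ∈ avoidRegion E (N + 1)} :=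
      (continuous_snoc.comp (Continuous.prodMk_left k)).measurable (hm (N + 1))
    have heq : (fun b : Fin N → ℝ => (avoidRegion E (N + 1)).indicator
        (fun a => ENNReal.ofReal |(monicPoly a).eval 1|) (Fin.snoc b k)) =
        {b : Fin N → ℝ | (Fin.snoc b k : Fin (N + 1) → ℝ) ∈ avoidRegion E (N + 1)}.indicator
        (fun b => ENNReal.ofReal |(monicPoly (Fin.snoc b k : Fin (N + 1) → ℝ)).eval 1|) := rfl
    rw [heq, lintegral_indicator hs]
    by_cases hk : |k| < 1
    · rw [hE.lintegral_section (hm N) hk, Set.indicator_of_mem]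
      exact ⟨(abs_lt.1 hk).1, (abs_lt.1 hk).2.le⟩
    · have hk1 : ¬ |k| ≤ 1 := fun h => by
        rcases lt_or_eq_of_le h with h | h
        · exact hk h
        · rcases eq_or_eq_neg_of_abs_eq h with h | h
          · exact h1 h
          · exact h2 h
      have he : {b : Fin N → ℝ | (Fin.snoc b k : Fin (N + 1) → ℝ) ∈ avoidRegion E (N + 1)} = ∅ :=
        Set.eq_empty_of_forall_notMem fun b hb => hk1 (hE.abs_last_le_one hb)
      rw [he, Measure.restrict_empty, lintegral_zero_measure, Set.indicator_of_notMem]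
      exact fun h => hk1 (abs_le.2 ⟨h.1.le, h.2⟩)
  have hc : Continuous fun k : ℝ => (1 + k) * ((1 - k ^ 2) ^ (N / 2) * (1 + k) ^ (N % 2)) := by
    fun_prop
  rw [evalOneIntegral, ← lintegral_indicator (hm (N + 1)),
    lintegral_eq_lintegral_snoc (hf.indicator (hm (N + 1))), lintegral_congr_ae hI,
    lintegral_indicator measurableSet_Ioc, lintegral_mul_const _ hc.measurable.ennreal_ofReal,
    evalOneFactor, intervalIntegral.integral_of_le (by norm_num),
    ofReal_integral_eq_lintegral_ofReal]
  · exact (hc.intervalIntegrable (-1) 1).1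
  · filter_upwards [ae_restrict_mem measurableSet_Ioc] with k hk
    have h1 : 0 < 1 + k := by linarith [hk.1]
    have h2 : 0 ≤ 1 - k ^ 2 := by nlinarith [hk.2]
    simp only [Pi.zero_apply]
    positivity

theorem IsExterior.evalOneIntegral_eq {E : Set ℂ} (hE : IsExterior E)
    (hm : ∀ N, MeasurableSet (avoidRegion E N)) : ∀ N : ℕ,
    evalOneIntegral E N = ∏ n ∈ Finset.range N, ENNReal.ofReal (evalOneFactor n)
  | 0 => by
    have h : avoidRegion E 0 = Set.univ := by ext a; simp [avoidRegion, monicPoly]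
    rw [evalOneIntegral, h]
    simp [monicPoly, volume_pi]
  | N + 1 => by
    rw [hE.evalOneIntegral_succ hm, hE.evalOneIntegral_eq hm N, Finset.prod_range_succ, mul_comm]

/-! ### Beta integrals and the closed form -/

theorem factorD_succ (m : ℕ) :
    factorD (m + 1) = factorD m * (2 * m + 2) / (2 * m + 3) := by
  have h : (2 * (m + 1) + 1)! = (2 * m + 3) * ((2 * m + 2) * (2 * m + 1)!) := by
    rw [show 2 * (m + 1) + 1 = (2 * m + 1) + 1 + 1 by ring, Nat.factorial_succ, Nat.factorial_succ]
  have h0 : ((2 * m + 1)! : ℝ) ≠ 0 := by exact_mod_cast Nat.factorial_ne_zero _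
  have h1 : (2 * m + 3 : ℝ) ≠ 0 := by positivity
  have h2 : (2 * m + 2 : ℝ) ≠ 0 := by positivity
  rw [factorD, factorD, h, Nat.factorial_succ]
  push_cast
  field_simp
  ring

theorem intervalIntegrable_one_sub_sq_pow (m : ℕ) :
    IntervalIntegrable (fun k : ℝ => (1 - k ^ 2) ^ m) volume (-1) 1 :=
  Continuous.intervalIntegrable (by fun_prop) _ _

theorem hasDerivAt_one_sub_sq_pow_succ (m : ℕ) (k : ℝ) :
    HasDerivAt (fun k : ℝ => (1 - k ^ 2) ^ (m + 1))
      ((m + 1) * (1 - k ^ 2) ^ m * (-(2 * k))) k := by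
  have h := (((hasDerivAt_id' k).fun_pow 2).const_sub 1).fun_pow (m + 1)
  simpa using h

theorem integral_one_sub_sq_pow : ∀ m : ℕ,
    ∫ k in (-1 : ℝ)..1, (1 - k ^ 2) ^ m = factorD m
  | 0 => by simp [factorD]; norm_num
  | m + 1 => by
    -- This primitive vanishes at `±1`, so its derivative relates the integrals for `m + 1` and `m`.
    have hd : ∀ k : ℝ, HasDerivAt (fun k : ℝ => k * (1 - k ^ 2) ^ (m + 1))
        ((2 * m + 3) * (1 - k ^ 2) ^ (m + 1) - (2 * m + 2) * (1 - k ^ 2) ^ m) k := fun k => by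
      refine ((hasDerivAt_id' k).fun_mul (hasDerivAt_one_sub_sq_pow_succ m k)).congr_deriv ?_
      ring
    have h := intervalIntegral.integral_eq_sub_of_hasDerivAt (a := -1) (b := 1) (fun k _ => hd k)
      (Continuous.intervalIntegrable (by fun_prop) _ _)
    rw [intervalIntegral.integral_sub
      ((intervalIntegrable_one_sub_sq_pow (m + 1)).const_mul _)
      ((intervalIntegrable_one_sub_sq_pow m).const_mul _),
      intervalIntegral.integral_const_mul, intervalIntegral.integral_const_mul,
      integral_one_sub_sq_pow m] at h
    have h1 : (2 * m + 3 : ℝ) ≠ 0 := by positivity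
    rw [factorD_succ, eq_div_iff h1]
    norm_num at h
    linarith

theorem integral_mul_one_sub_sq_pow (m : ℕ) :
    ∫ k in (-1 : ℝ)..1, k * (1 - k ^ 2) ^ m = 0 := by
  have hd : ∀ k : ℝ, HasDerivAt (fun k : ℝ => -(1 - k ^ 2) ^ (m + 1) / (2 * (m + 1)))
      (k * (1 - k ^ 2) ^ m) k := fun k => by
    refine ((hasDerivAt_one_sub_sq_pow_succ m k).fun_neg.div_const (2 * (m + 1))).congr_deriv ?_
    have h1 : (m + 1 : ℝ) ≠ 0 := by positivity
    field_simp
  rw [intervalIntegral.integral_eq_sub_of_hasDerivAt (a := -1) (b := 1) (fun k _ => hd k)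
    (Continuous.intervalIntegrable (by fun_prop) _ _)]
  norm_num

theorem evalOneFactor_two_mul (m : ℕ) : evalOneFactor (2 * m) = factorD m := by
  have h : ∀ k : ℝ, (1 + k) * ((1 - k ^ 2) ^ (2 * m / 2) * (1 + k) ^ (2 * m % 2)) =
      (1 - k ^ 2) ^ m + k * (1 - k ^ 2) ^ m := fun k => by
    rw [Nat.mul_div_cancel_left m two_pos, Nat.mul_mod_right]
    ring
  simp only [evalOneFactor, h]
  rw [intervalIntegral.integral_add (Continuous.intervalIntegrable (by fun_prop) _ _)
    (Continuous.intervalIntegrable (by fun_prop) _ _), integral_one_sub_sq_pow,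
    integral_mul_one_sub_sq_pow, add_zero]

theorem evalOneFactor_two_mul_add_one (m : ℕ) :
    evalOneFactor (2 * m + 1) = factorD m * (2 * m + 4) / (2 * m + 3) := by
  -- Uses `(1 + k)² = 2 + 2k - (1 - k²)`; the term odd in `k` integrates to 0.
  have h : ∀ k : ℝ, (1 + k) * ((1 - k ^ 2) ^ ((2 * m + 1) / 2) * (1 + k) ^ ((2 * m + 1) % 2)) =
      2 * (1 - k ^ 2) ^ m + 2 * (k * (1 - k ^ 2) ^ m) - (1 - k ^ 2) ^ (m + 1) := fun k => by
    rw [show (2 * m + 1) / 2 = m by omega, show (2 * m + 1) % 2 = 1 by omega]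
    ring
  simp only [evalOneFactor, h]
  rw [intervalIntegral.integral_sub (Continuous.intervalIntegrable (by fun_prop) _ _)
    (Continuous.intervalIntegrable (by fun_prop) _ _),
    intervalIntegral.integral_add (Continuous.intervalIntegrable (by fun_prop) _ _)
    (Continuous.intervalIntegrable (by fun_prop) _ _), intervalIntegral.integral_const_mul,
    intervalIntegral.integral_const_mul, integral_one_sub_sq_pow, integral_one_sub_sq_pow,
    integral_mul_one_sub_sq_pow, factorD_succ]
  have h1 : (2 * m + 3 : ℝ) ≠ 0 := by positivity
  field_simp
  ring

theorem factorD_nonneg (m : ℕ) : 0 ≤ factorD m := by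
  rw [factorD]; positivity

theorem evalOneFactor_nonneg (n : ℕ) : 0 ≤ evalOneFactor n := by
  rcases Nat.even_or_odd' n with ⟨m, rfl | rfl⟩
  · rw [evalOneFactor_two_mul]
    exact factorD_nonneg m
  · have := factorD_nonneg m
    rw [evalOneFactor_two_mul_add_one]
    positivity

theorem prod_evalOneFactor_two_mul (m : ℕ) :
    4 * ∏ n ∈ Finset.range (2 * m), evalOneFactor n =
      (2 * m + 2) * (factorD m * ∏ k ∈ Finset.range m, factorD k ^ 2) := by
  induction m with
  | zero => simp [factorD]; norm_num
  | succ m ih =>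
    have h1 : (2 * m + 3 : ℝ) ≠ 0 := by positivity
    rw [mul_add_one, Finset.prod_range_succ, Finset.prod_range_succ, ← mul_assoc,
      ← mul_assoc, ih, evalOneFactor_two_mul, evalOneFactor_two_mul_add_one, factorD_succ,
      Finset.prod_range_succ]
    push_cast
    field_simp
    ring

theorem prod_evalOneFactor_of_even {M : ℕ} (hM : Odd (M + 1)) :
    4 / (((M + 1 : ℕ) : ℝ) * (((M + 1 : ℕ) : ℝ) + 1)) * ∏ n ∈ Finset.range M, evalOneFactor n =
      constD (M + 1) / ((M + 1 : ℕ) : ℝ) := by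
  obtain ⟨m, hm⟩ := hM
  obtain rfl : M = 2 * m := by omega
  have h := prod_evalOneFactor_two_mul m
  rw [constD, if_neg (by rw [Nat.not_even_iff_odd]; exact ⟨m, rfl⟩),
    show (2 * m + 1) / 2 = m by omega]
  push_cast
  have h1 : (2 * m + 2 : ℝ) ≠ 0 := by positivity
  have h2 : (2 * m + 1 : ℝ) ≠ 0 := by positivity
  rw [show (2 * (m : ℝ) + 1 + 1) = 2 * m + 2 by ring, div_mul_eq_mul_div, h]
  field_simp

theorem prod_evalOneFactor_of_odd {M : ℕ} (hM : Even (M + 1)) :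
    4 / (((M + 1 : ℕ) : ℝ) * (((M + 1 : ℕ) : ℝ) + 1)) * ∏ n ∈ Finset.range M, evalOneFactor n =
      constD (M + 1) / (((M + 1 : ℕ) : ℝ) + 1) := by
  have hM' := hM
  obtain ⟨j, hj⟩ := hM
  obtain ⟨m, rfl⟩ : ∃ m, M = 2 * m + 1 := ⟨j - 1, by omega⟩
  have h := prod_evalOneFactor_two_mul m
  rw [constD, if_pos hM', show (2 * m + 1 + 1) / 2 = m + 1 by omega, Finset.prod_range_succ,
    Finset.prod_range_succ, evalOneFactor_two_mul]
  push_cast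
  have h1 : (2 * m + 2 : ℝ) ≠ 0 := by positivity
  have h2 : (2 * m + 3 : ℝ) ≠ 0 := by positivity
  rw [show (2 * (m : ℝ) + 1 + 1) = 2 * m + 2 by ring, show (2 * (m : ℝ) + 2 + 1) = 2 * m + 3 by ring,
    div_mul_eq_mul_div, ← mul_assoc, h]
  field_simp

/-! ### The Selberg-type integral without absolute values -/

/-- A monic polynomial negative at 1 tends to `+∞`, so it would have a real root beyond 1. -/
theorem IsExterior.eval_one_nonneg {E : Set ℂ} (hE : IsExterior E) {N : ℕ} {a : Fin N → ℝ}
    (ha : a ∈ avoidRegion E N) : 0 ≤ (monicPoly a).eval 1 := by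
  by_contra! h
  have hN : 0 < (monicPoly a).degree := by
    by_contra! h0
    rw [(monic_monicPoly a).degree_le_zero_iff_eq_one.1 h0] at h
    simp at h
    linarith
  have ht := (monicPoly a).tendsto_atTop_of_leadingCoeff_nonneg hN
    (by rw [(monic_monicPoly a).leadingCoeff]; exact zero_le_one)
  obtain ⟨x, hx, hx1⟩ := ((ht.eventually_gt_atTop 0).and (Filter.eventually_gt_atTop 1)).exists
  obtain ⟨y, hy, hy0⟩ := intermediate_value_Ioo hx1.le (monicPoly a).continuousOn ⟨h, hx⟩
  have h1 : aeval (y : ℂ) (monicPoly a) = 0 := by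
    rw [← Complex.coe_algebraMap, aeval_algebraMap_apply, coe_aeval_eq_eval]
    simp only [hy0, map_zero]
  have h2 := hE.norm_le_one ha h1
  rw [Complex.norm_real, Real.norm_eq_abs] at h2
  exact absurd (le_abs_self y) (by linarith [hy.1])

theorem selbergC_one_one (N : ℕ) :
    selbergC N 1 1 = ∏ n ∈ Finset.range N, evalOneFactor n := by
  have hm := measurableSet_avoidRegion_one_lt N
  have hc : Continuous fun a : Fin N → ℝ => (monicPoly a).eval 1 :=
    (continuous_monicPoly_eval (N := N)).comp (Continuous.prodMk_left (1 : ℝ))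
  have h := isExterior_one_lt.evalOneIntegral_eq measurableSet_avoidRegion_one_lt N
  simp only [selbergC, sub_self, Real.rpow_zero, one_mul]
  rw [rootRegion_eq_avoidRegion, integral_eq_lintegral_of_nonneg_ae _
    hc.aestronglyMeasurable.restrict]
  · rw [← ENNReal.ofReal_prod_of_nonneg fun n _ => evalOneFactor_nonneg n, evalOneIntegral] at h
    rw [← ENNReal.toReal_ofReal (Finset.prod_nonneg fun n _ => evalOneFactor_nonneg n), ← h]
    congr 1
    refine setLIntegral_congr_fun hm fun a ha => ?_
    simp only [abs_of_nonneg (isExterior_one_lt.eval_one_nonneg ha)]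
  · filter_upwards [ae_restrict_mem hm] with a ha
    exact isExterior_one_lt.eval_one_nonneg ha

/-! ### Splitting off the Perron root -/

theorem aroots_mulRoot {N : ℕ} (r : ℝ) (q : Fin N → ℝ) :
    (monicPoly (mulRoot r q)).aroots ℂ = (r : ℂ) ::ₘ (monicPoly q).aroots ℂ := by
  rw [monicPoly_mulRoot, aroots_mul (mul_ne_zero (X_sub_C_ne_zero r) (monic_monicPoly q).ne_zero),
    aroots_X_sub_C, Multiset.singleton_add, Complex.coe_algebraMap]

theorem mem_aroots_monicPoly {N : ℕ} {a : Fin N → ℝ} {z : ℂ} :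
    z ∈ (monicPoly a).aroots ℂ ↔ aeval z (monicPoly a) = 0 := by
  rw [mem_aroots, and_iff_right (monic_monicPoly a).ne_zero]

/-- The pairs `(r, q)` with `|r| ≤ 1` such that all roots of `monicPoly q` are smaller than `r` in
absolute value. -/
def perronPairs (N : ℕ) : Set (ℝ × (Fin N → ℝ)) :=
  {p | |p.1| ≤ 1 ∧ p.2 ∈ avoidRegion {z | |p.1| ≤ ‖z‖} N}

theorem mulRoot_mem_perronRegion {N : ℕ} {r : ℝ} {q : Fin N → ℝ} (h : (r, q) ∈ perronPairs N) :
    mulRoot r q ∈ perronRegion (N + 1) := by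
  have hlt : ∀ z ∈ (monicPoly q).aroots ℂ, ‖z‖ < ‖(r : ℂ)‖ := fun z hz => by
    rw [Complex.norm_real, Real.norm_eq_abs]
    exact not_le.1 (h.2 z (mem_aroots_monicPoly.1 hz))
  refine ⟨fun z hz => ?_, r, _, aroots_mulRoot r q, hlt⟩
  have hr : ‖(r : ℂ)‖ ≤ 1 := by rw [Complex.norm_real]; exact h.1
  rw [← mem_aroots_monicPoly, aroots_mulRoot, Multiset.mem_cons] at hz
  rcases hz with rfl | hz
  · exact hr
  · exact (hlt z hz).le.trans hr

theorem exists_perronPairs {N : ℕ} {a : Fin (N + 1) → ℝ} (h : a ∈ perronRegion (N + 1)) :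
    ∃ p ∈ perronPairs N, mulRoot p.1 p.2 = a := by
  obtain ⟨ha, α, s, hs, hlt⟩ := h
  have hα : aeval α (monicPoly a) = 0 := by
    rw [← mem_aroots_monicPoly, hs]; exact Multiset.mem_cons_self α s
  have hc : (starRingEnd ℂ) α ∈ (monicPoly a).aroots ℂ := by
    rw [mem_aroots_monicPoly, aeval_conj, hα, map_zero]
  -- The conjugate of `α` is a root of equal absolute value, so it cannot be among the strictly
  -- smaller ones.
  obtain ⟨r, rfl⟩ : ∃ r : ℝ, α = r := by
    rw [← Complex.conj_eq_iff_real]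
    rw [hs, Multiset.mem_cons] at hc
    refine hc.resolve_right fun hc => ?_
    simpa using hlt _ hc
  have hr : (monicPoly a).IsRoot r := by
    rw [← Complex.coe_algebraMap, aeval_algebraMap_apply, coe_aeval_eq_eval] at hα
    simpa using hα
  obtain ⟨Q, hQ⟩ := dvd_iff_isRoot.2 hr
  have hQm : Q.Monic := (monic_X_sub_C r).of_mul_monic_left (hQ ▸ monic_monicPoly a)
  have hQd : Q.natDegree = N := by
    have := natDegree_monicPoly a
    rw [hQ, (monic_X_sub_C r).natDegree_mul hQm, natDegree_X_sub_C] at this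
    omega
  obtain ⟨q, rfl⟩ := exists_monicPoly_eq hQm hQd
  obtain rfl : a = mulRoot r q := monicPoly_injective (by rw [hQ, monicPoly_mulRoot])
  refine ⟨(r, q), ⟨?_, fun z hz => ?_⟩, rfl⟩
  · have := ha r hα
    rwa [Complex.norm_real, Real.norm_eq_abs] at this
  · rw [aroots_mulRoot, Multiset.cons_inj_right] at hs
    have := hlt z (by rw [← hs, mem_aroots_monicPoly]; exact hz)
    rw [Complex.norm_real, Real.norm_eq_abs] at this
    exact not_le.2 this

theorem perronRegion_succ (N : ℕ) :
    perronRegion (N + 1) = (fun p => mulRoot p.1 p.2) '' perronPairs N := by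
  ext a
  constructor
  · intro h
    exact exists_perronPairs h
  · rintro ⟨p, hp, rfl⟩
    exact mulRoot_mem_perronRegion hp

theorem eq_or_abs_lt_of_mulRoot_eq {N : ℕ} {r r' : ℝ} {q q' : Fin N → ℝ}
    (hq : (r, q) ∈ perronPairs N) (h : mulRoot r q = mulRoot r' q') : r' = r ∨ |r'| < |r| := by
  have h1 : (r' : ℂ) ∈ (monicPoly (mulRoot r q)).aroots ℂ := by
    rw [h, aroots_mulRoot]; exact Multiset.mem_cons_self _ _
  rw [aroots_mulRoot, Multiset.mem_cons] at h1
  refine h1.imp (fun h => by exact_mod_cast h) fun h => ?_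
  have := hq.2 _ (mem_aroots_monicPoly.1 h)
  simpa using this

theorem mulRoot_injOn (N : ℕ) :
    Set.InjOn (fun p : ℝ × (Fin N → ℝ) => mulRoot p.1 p.2) (perronPairs N) := by
  rintro ⟨r, q⟩ hq ⟨r', q'⟩ hq' h
  have h : mulRoot r q = mulRoot r' q' := h
  obtain rfl : r = r' := by
    rcases eq_or_abs_lt_of_mulRoot_eq hq h with h1 | h1
    · exact h1.symm
    · rcases eq_or_abs_lt_of_mulRoot_eq hq' h.symm with h2 | h2
      · exact h2
      · exact absurd h1 h2.not_gt
  have h2 := congrArg monicPoly h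
  rw [monicPoly_mulRoot, monicPoly_mulRoot] at h2
  rw [monicPoly_injective (mul_left_cancel₀ (X_sub_C_ne_zero r) h2)]

theorem measurableSet_perronPairs (N : ℕ) : MeasurableSet (perronPairs N) := by
  have hK : IsClosed {p : (ℝ × (Fin N → ℝ)) × ℂ |
      aeval p.2 (monicPoly p.1.2) = 0 ∧ |p.1.1| ≤ ‖p.2‖} := by
    refine (isClosed_eq ?_ continuous_const).inter (isClosed_le
      (continuous_abs.comp (continuous_fst.comp continuous_fst)) continuous_snd.norm)
    exact continuous_aeval_monicPoly.comp
      ((continuous_snd.comp continuous_fst).prodMk continuous_snd)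
  have h1 : MeasurableSet {p : ℝ × (Fin N → ℝ) | |p.1| ≤ 1} :=
    (isClosed_le (continuous_abs.comp continuous_fst) continuous_const).measurableSet
  convert h1.inter hK.measurableSet_image_fst.compl using 1
  ext p
  simp [perronPairs, avoidRegion]

theorem continuous_mulRoot (N : ℕ) :
    Continuous fun p : ℝ × (Fin N → ℝ) => mulRoot p.1 p.2 := by
  refine continuous_pi fun i => ?_
  refine Continuous.sub ?_ (continuous_fst.mul ?_)
  · induction i using Fin.lastCases with
    | last => simpa using continuous_const
    | cast i => simpa using by fun_prop
  · induction i using Fin.cases with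
    | zero => simpa using continuous_const
    | succ i => simpa using by fun_prop

/-- An injective continuous image of a Borel set is Borel (Lusin–Souslin). -/
theorem measurableSet_perronRegion_succ (N : ℕ) : MeasurableSet (perronRegion (N + 1)) := by
  rw [perronRegion_succ]
  exact (measurableSet_perronPairs N).image_of_continuousOn_injOn
    (continuous_mulRoot N).continuousOn (mulRoot_injOn N)

/-! ### The Jacobian of `(r, Q) ↦ (x - r) Q` -/

/-- The coefficients of `(x - r) Q(x)` except for the constant one. -/
def rootShift {N : ℕ} (r : ℝ) (q : Fin N → ℝ) : Fin N → ℝ := Fin.init (mulRoot r q)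

theorem rootShift_identity {N : ℕ} (r : ℝ) (q : Fin N → ℝ) :
    X * monicPoly (rootShift r q) - C (r * (monicPoly (rootShift r q)).eval r) =
      (X - C r) * monicPoly q := by
  have h := monicPoly_mulRoot r q
  rw [← Fin.snoc_init_self (mulRoot r q), monicPoly_snoc] at h
  have h0 := congrArg (eval r) h
  simp only [eval_add, eval_mul, eval_X, eval_C, eval_sub, sub_self, zero_mul] at h0
  rw [← h, sub_eq_add_neg, ← C_neg, rootShift, neg_eq_of_add_eq_zero_right h0]

theorem mulRoot_eq_snoc {N : ℕ} (r : ℝ) (q : Fin N → ℝ) :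
    mulRoot r q = Fin.snoc (rootShift r q) (-(r * (monicPoly (rootShift r q)).eval r)) := by
  apply monicPoly_injective
  rw [monicPoly_mulRoot, monicPoly_snoc, ← rootShift_identity, C_neg, sub_eq_add_neg]

/-- Both sides are `P'(r)` for `P = (x - r) Q`; the constant coefficient does not affect the
derivative. -/
theorem eval_derivative_rootShift {N : ℕ} (r : ℝ) (q : Fin N → ℝ) :
    (derivative (X * monicPoly (rootShift r q))).eval r = (monicPoly q).eval r := by
  have h := congrArg (fun P => (derivative P).eval r) (rootShift_identity r q)
  simp only [derivative_sub, derivative_C, sub_zero, derivative_mul, derivative_X, one_mul,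
    eval_add, eval_mul, eval_sub, eval_X, eval_C, sub_self, zero_mul, add_zero] at h ⊢
  exact h

/-- The matrix of the linear part of `rootShift r`. -/
noncomputable def shiftMatrix (N : ℕ) (r : ℝ) : Matrix (Fin N) (Fin N) ℝ :=
  Matrix.of fun i j => (if i = j then 1 else 0) - r * if (i : ℕ) = j + 1 then 1 else 0

theorem det_shiftMatrix (N : ℕ) (r : ℝ) : (shiftMatrix N r).det = 1 := by
  rw [Matrix.det_of_isLowerTriangular]
  · simp [shiftMatrix]
  · intro i j hij
    have hij : i < j := hij
    have h1 : i ≠ j := hij.ne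
    have h2 : (i : ℕ) ≠ j + 1 := by rw [Fin.lt_def] at hij; omega
    simp [shiftMatrix, h1, h2]

theorem rootShift_apply {N : ℕ} (r : ℝ) (q : Fin N → ℝ) (i : Fin N) :
    rootShift r q i = q i - r * (Fin.cons 1 q : Fin (N + 1) → ℝ) i.castSucc := by
  simp [rootShift, Fin.init, mulRoot]

theorem rootShift_eq {N : ℕ} (r : ℝ) (q : Fin N → ℝ) :
    rootShift r q = Matrix.toLin' (shiftMatrix N r) q + rootShift r 0 := by
  ext i
  have h1 : Matrix.toLin' (shiftMatrix N r) q i =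
      q i - r * ∑ j : Fin N, if (i : ℕ) = j + 1 then q j else 0 := by
    simp [shiftMatrix, Matrix.mulVec, dotProduct, sub_mul, Finset.sum_sub_distrib,
      Finset.mul_sum]
  rw [Pi.add_apply, h1, rootShift_apply, rootShift_apply]
  cases N with
  | zero => exact i.elim0
  | succ N =>
    induction i using Fin.cases with
    | zero => simp; ring
    | succ i =>
      have h2 : ∀ j : Fin (N + 1), ((i.succ : Fin (N + 1)) : ℕ) = j + 1 ↔ i.castSucc = j :=
        fun j => by simp [Fin.ext_iff]
      simp only [h2, Fin.castSucc_succ, Fin.cons_succ]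
      simp

theorem shiftMatrix_toLin'_injective (N : ℕ) (r : ℝ) :
    Function.Injective (Matrix.toLin' (shiftMatrix N r)) := by
  simp only [Function.Injective, Matrix.toLin'_apply]
  exact Matrix.mulVec_injective_iff_isUnit.2
    ((Matrix.isUnit_iff_isUnit_det _).2 (by rw [det_shiftMatrix]; exact isUnit_one))

theorem rootShift_injective {N : ℕ} (r : ℝ) : Function.Injective (rootShift (N := N) r) :=
  fun a b h => by
    rw [rootShift_eq r a, rootShift_eq r b] at h
    exact shiftMatrix_toLin'_injective N r (add_right_cancel h)

theorem setLIntegral_rootShift {N : ℕ} (r : ℝ) {s : Set (Fin N → ℝ)} (hs : MeasurableSet s)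
    (f : (Fin N → ℝ) → ENNReal) :
    ∫⁻ x in rootShift r '' s, f x = ∫⁻ x in s, f (rootShift r x) := by
  have h := setLIntegral_image_affine _ (rootShift r 0) (shiftMatrix_toLin'_injective N r) hs f
  simp only [← rootShift_eq, LinearMap.det_toLin', det_shiftMatrix, abs_one, ENNReal.ofReal_one,
    one_mul] at h
  exact h

theorem continuous_rootShift (N : ℕ) :
    Continuous fun p : ℝ × (Fin N → ℝ) => rootShift p.1 p.2 :=
  continuous_pi fun i => (continuous_apply i.castSucc).comp (continuous_mulRoot N)

/-- The pairs of the largest root and the coefficients, without the constant one, of the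
polynomials in the Perron region. -/
def shiftedPairs (N : ℕ) : Set (ℝ × (Fin N → ℝ)) :=
  (fun p => (p.1, rootShift p.1 p.2)) '' perronPairs N

theorem measurableSet_shiftedPairs (N : ℕ) : MeasurableSet (shiftedPairs N) := by
  refine (measurableSet_perronPairs N).image_of_continuousOn_injOn
    (continuous_fst.prodMk (continuous_rootShift N)).continuousOn ?_
  rintro ⟨r, q⟩ - ⟨r', q'⟩ - h
  obtain ⟨h1, h2⟩ := Prod.mk.inj h
  obtain rfl : r = r' := h1
  obtain rfl : q = q' := rootShift_injective r h2
  rfl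

/-- The density `|P'(r)|`, where `P(x) = x B(x) + c` and `B` has coefficient vector `b`. -/
noncomputable def rootDensity {N : ℕ} (r : ℝ) (b : Fin N → ℝ) : ENNReal :=
  ENNReal.ofReal |(derivative (X * monicPoly b)).eval r|

theorem measurable_rootDensity (N : ℕ) :
    Measurable fun p : ℝ × (Fin N → ℝ) => rootDensity p.1 p.2 := by
  refine (Continuous.measurable ?_).ennreal_ofReal
  refine continuous_abs.comp ?_
  simp only [monicPoly, derivative_mul, derivative_X, derivative_add, derivative_X_pow,
    derivative_sum, derivative_C, eval_add, eval_mul, eval_pow, eval_X, eval_finsetSum, eval_C,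
    zero_mul, one_mul, zero_add, eval_natCast, map_natCast]
  fun_prop

theorem setOf_snoc_mem_perronRegion {N : ℕ} (b : Fin N → ℝ) :
    {k | (Fin.snoc b k : Fin (N + 1) → ℝ) ∈ perronRegion (N + 1)} =
      (fun r => (-(X * monicPoly b)).eval r) '' {r | (r, b) ∈ shiftedPairs N} := by
  ext k
  rw [Set.mem_ofPred_eq, perronRegion_succ]
  constructor
  · rintro ⟨⟨r, q⟩, hq, h⟩
    simp only [mulRoot_eq_snoc] at h
    obtain ⟨rfl, rfl⟩ := Fin.snoc_inj.1 h
    exact ⟨r, ⟨(r, q), hq, rfl⟩, by simp⟩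
  · rintro ⟨r, ⟨⟨r', q⟩, hq, h⟩, rfl⟩
    obtain ⟨rfl, rfl⟩ := Prod.mk.inj h
    exact ⟨(r', q), hq, by simp [mulRoot_eq_snoc]⟩

theorem injOn_eval_neg {N : ℕ} (b : Fin N → ℝ) :
    Set.InjOn (fun r => (-(X * monicPoly b)).eval r) {r | (r, b) ∈ shiftedPairs N} := by
  rintro r ⟨⟨r₁, q₁⟩, hq₁, h₁⟩ s ⟨⟨r₂, q₂⟩, hq₂, h₂⟩ h
  obtain ⟨rfl, rfl⟩ := Prod.mk.inj h₁
  have h₃ : rootShift r₂ q₂ = rootShift r₁ q₁ := (Prod.mk.inj h₂).2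
  obtain rfl : r₂ = s := (Prod.mk.inj h₂).1
  refine congrArg Prod.fst (mulRoot_injOn N hq₁ hq₂ ?_)
  simp only [mulRoot_eq_snoc]
  rw [h₃]
  congr 1
  simpa using h

/-- With the other coefficients fixed, the constant one is `-r B(r)`, a function of the Perron root
`r` alone and injective because that root is unique. Its derivative is `-P'(r)`. -/
theorem volume_section_perronRegion {N : ℕ} (b : Fin N → ℝ) :
    volume {k | (Fin.snoc b k : Fin (N + 1) → ℝ) ∈ perronRegion (N + 1)} =
      ∫⁻ r in {r | (r, b) ∈ shiftedPairs N}, rootDensity r b := by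
  have hs : MeasurableSet {r | (r, b) ∈ shiftedPairs N} :=
    measurable_prodMk_right (measurableSet_shiftedPairs N)
  rw [setOf_snoc_mem_perronRegion, ← setLIntegral_one, lintegral_image_eq_lintegral_abs_deriv_mul hs
    (fun r _ => ((-(X * monicPoly b)).hasDerivAt r).hasDerivWithinAt) (injOn_eval_neg b)]
  simp only [derivative_neg, eval_neg, abs_neg, mul_one, rootDensity]

theorem section_shiftedPairs {N : ℕ} {r : ℝ} (hr : |r| ≤ 1) :
    {b : Fin N → ℝ | (r, b) ∈ shiftedPairs N} =
      rootShift r '' avoidRegion {z | |r| ≤ ‖z‖} N := by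
  ext b
  constructor
  · rintro ⟨⟨r', q⟩, hq, h⟩
    obtain ⟨rfl, rfl⟩ := Prod.mk.inj h
    exact ⟨q, hq.2, rfl⟩
  · rintro ⟨q, hq, rfl⟩
    exact ⟨(r, q), ⟨hr, hq⟩, rfl⟩

theorem section_shiftedPairs_eq_empty {N : ℕ} {r : ℝ} (hr : ¬ |r| ≤ 1) :
    {b : Fin N → ℝ | (r, b) ∈ shiftedPairs N} = ∅ := by
  refine Set.eq_empty_of_forall_notMem ?_
  rintro b ⟨⟨r', q⟩, hq, h⟩
  obtain ⟨rfl, rfl⟩ := Prod.mk.inj h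
  exact hr hq.1

theorem measurableSet_avoidRegion_le (c : ℝ) (N : ℕ) :
    MeasurableSet (avoidRegion {z | c ≤ ‖z‖} N) :=
  measurableSet_avoidRegion_of_isClosed (isClosed_le continuous_const continuous_norm) N

/-- Tonelli reduces the Jacobian to two simpler substitutions: at fixed `b` the constant coefficient
is traded for `r`, at density `|P'(r)|`; at fixed `r` the vector `b` is traded for `q` by a
unipotent affine map, which turns the density into `|Q(r)|`. -/
theorem volume_perronRegion_succ (N : ℕ) :
    volume (perronRegion (N + 1)) = ∫⁻ r in {r : ℝ | |r| ≤ 1},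
      ∫⁻ q in avoidRegion {z | |r| ≤ ‖z‖} N, ENNReal.ofReal |(monicPoly q).eval r| := by
  have hP := measurableSet_perronRegion_succ N
  have hD := measurableSet_shiftedPairs N
  have hI : Measurable ((perronRegion (N + 1)).indicator (1 : (Fin (N + 1) → ℝ) → ENNReal)) :=
    measurable_one.indicator hP
  have hw : Measurable ((shiftedPairs N).indicator fun p => rootDensity p.1 p.2) :=
    (measurable_rootDensity N).indicator hD
  have h1 : ∀ b : Fin N → ℝ, ∫⁻ k : ℝ,
      (perronRegion (N + 1)).indicator (1 : (Fin (N + 1) → ℝ) → ENNReal) (Fin.snoc b k) =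
      ∫⁻ r : ℝ, (shiftedPairs N).indicator (fun p => rootDensity p.1 p.2) (r, b) := fun b => by
    have hs : MeasurableSet {k | (Fin.snoc b k : Fin (N + 1) → ℝ) ∈ perronRegion (N + 1)} :=
      (continuous_snoc.comp (Continuous.prodMk_right b)).measurable hP
    have hs' : MeasurableSet {r | (r, b) ∈ shiftedPairs N} := measurable_prodMk_right hD
    have h2 := volume_section_perronRegion b
    rw [← lintegral_indicator_one hs, ← lintegral_indicator hs'] at h2
    exact h2
  have h3 : ∀ r : ℝ, ∫⁻ b : Fin N → ℝ,
      (shiftedPairs N).indicator (fun p => rootDensity p.1 p.2) (r, b) =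
      {r : ℝ | |r| ≤ 1}.indicator (fun r => ∫⁻ q in avoidRegion {z | |r| ≤ ‖z‖} N,
        ENNReal.ofReal |(monicPoly q).eval r|) r := fun r => by
    have hs : MeasurableSet {b | (r, b) ∈ shiftedPairs N} := measurable_prodMk_left hD
    have h4 : ∫⁻ b : Fin N → ℝ,
        (shiftedPairs N).indicator (fun p => rootDensity p.1 p.2) (r, b) =
        ∫⁻ b in {b | (r, b) ∈ shiftedPairs N}, rootDensity r b := by
      rw [← lintegral_indicator hs]
      rfl
    rw [h4]
    by_cases hr : |r| ≤ 1
    · rw [section_shiftedPairs hr, setLIntegral_rootShift r (measurableSet_avoidRegion_le _ N),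
        Set.indicator_of_mem (Set.mem_ofPred_eq ▸ hr)]
      simp only [rootDensity, eval_derivative_rootShift]
    · rw [section_shiftedPairs_eq_empty hr, Measure.restrict_empty, lintegral_zero_measure,
        Set.indicator_of_notMem (s := {r : ℝ | |r| ≤ 1}) hr]
  rw [← lintegral_indicator_one hP, lintegral_eq_lintegral_snoc hI, lintegral_lintegral_swap]
  · simp only [h1]
    rw [lintegral_lintegral_swap]
    · simp only [h3]
      rw [lintegral_indicator (isClosed_le continuous_abs continuous_const).measurableSet]
    · exact (hw.comp measurable_swap).aemeasurable
  · exact (hI.comp (continuous_snoc.measurable.comp measurable_swap)).aemeasurable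

/-! ### Scaling the roots and conclusion -/

/-- The matrix of the change of coefficients that multiplies all roots by `r`. -/
noncomputable def scaleMatrix (N : ℕ) (r : ℝ) : Matrix (Fin N) (Fin N) ℝ :=
  Matrix.diagonal fun i => r ^ ((i : ℕ) + 1)

theorem aeval_scale {A : Type*} [CommRing A] [Algebra ℝ A] {N : ℕ} (r : ℝ) (q : Fin N → ℝ)
    (z : A) : aeval (algebraMap ℝ A r * z) (monicPoly (Matrix.toLin' (scaleMatrix N r) q)) =
      algebraMap ℝ A r ^ N * aeval z (monicPoly q) := by
  rw [aeval_monicPoly, aeval_monicPoly, mul_add, mul_pow, Finset.mul_sum]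
  congr 1
  refine Finset.sum_congr rfl fun i _ => ?_
  have h : N = (i : ℕ) + 1 + (N - 1 - i) := by have := i.2; omega
  have h' : algebraMap ℝ A r ^ N =
      algebraMap ℝ A r ^ ((i : ℕ) + 1) * algebraMap ℝ A r ^ (N - 1 - (i : ℕ)) := by
    rw [← pow_add, ← h]
  rw [Matrix.toLin'_apply, scaleMatrix, Matrix.mulVec_diagonal, map_mul, map_pow, mul_pow, h']
  ring

theorem scale_injective (N : ℕ) {r : ℝ} (hr : r ≠ 0) :
    Function.Injective (Matrix.toLin' (scaleMatrix N r)) := fun a b h => by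
  ext i
  have := congrFun h i
  simpa [Matrix.toLin'_apply, scaleMatrix, Matrix.mulVec_diagonal, hr] using this

theorem scale_surjective (N : ℕ) {r : ℝ} (hr : r ≠ 0) :
    Function.Surjective (Matrix.toLin' (scaleMatrix N r)) :=
  LinearMap.injective_iff_surjective.1 (scale_injective N hr)

theorem avoidRegion_eq_image_scale (N : ℕ) {r : ℝ} (hr : r ≠ 0) :
    avoidRegion {z | |r| ≤ ‖z‖} N =
      Matrix.toLin' (scaleMatrix N r) '' avoidRegion {z | 1 ≤ ‖z‖} N := by
  have hr' : (r : ℂ) ≠ 0 := by exact_mod_cast hr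
  ext b
  obtain ⟨a, rfl⟩ := scale_surjective N hr b
  rw [(scale_injective N hr).mem_set_image]
  have hn : ∀ z : ℂ, ‖(r : ℂ) * z‖ = |r| * ‖z‖ := fun z => by
    rw [norm_mul, Complex.norm_real, Real.norm_eq_abs]
  constructor
  · intro h z hz hz1
    refine h (r * z) ?_ ?_
    · rw [← Complex.coe_algebraMap, aeval_scale, hz, mul_zero]
    · simp only [Set.mem_ofPred_eq, hn] at hz1 ⊢
      exact le_mul_of_one_le_right (abs_nonneg r) hz1
  · intro h z hz hz1
    obtain ⟨w, rfl⟩ : ∃ w, z = r * w := ⟨z / r, by field_simp⟩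
    rw [← Complex.coe_algebraMap, aeval_scale, mul_eq_zero, Complex.coe_algebraMap] at hz
    refine h w (hz.resolve_left (pow_ne_zero _ hr')) ?_
    simp only [Set.mem_ofPred_eq, hn] at hz1 ⊢
    exact le_of_mul_le_mul_left (by simpa using hz1) (abs_pos.2 hr)

/-- The determinant of the scaling gives the exponent `1 + ⋯ + N`; the further `N` comes from the
value at `r`, which is `r ^ N` times the value at 1 before scaling. -/
theorem setLIntegral_eval_scale (N : ℕ) {r : ℝ} (hr : r ≠ 0) :
    ∫⁻ q in avoidRegion {z | |r| ≤ ‖z‖} N, ENNReal.ofReal |(monicPoly q).eval r| =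
      ENNReal.ofReal (|r| ^ (∑ i ∈ Finset.range N, (i + 1) + N)) *
        evalOneIntegral {z | 1 ≤ ‖z‖} N := by
  have h := setLIntegral_image_affine _ 0 (scale_injective N hr)
    (measurableSet_avoidRegion_one_le N) (fun q => ENNReal.ofReal |(monicPoly q).eval r|)
  have he : ∀ q : Fin N → ℝ, (monicPoly (Matrix.toLin' (scaleMatrix N r) q)).eval r =
      r ^ N * (monicPoly q).eval 1 := fun q => by
    simpa [coe_aeval_eq_eval] using aeval_scale r q (1 : ℝ)
  have hd : LinearMap.det (Matrix.toLin' (scaleMatrix N r)) =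
      r ^ ∑ i ∈ Finset.range N, (i + 1) := by
    rw [LinearMap.det_toLin', scaleMatrix, Matrix.det_diagonal, Finset.prod_pow_eq_pow_sum,
      Fin.sum_univ_eq_sum_range (fun i => i + 1)]
  simp only [add_zero, he, hd, abs_mul, abs_pow] at h
  simp only [ENNReal.ofReal_mul (pow_nonneg (abs_nonneg r) N)] at h
  rw [avoidRegion_eq_image_scale N hr, h, lintegral_const_mul' _ _ ENNReal.ofReal_ne_top,
    ← mul_assoc, ← ENNReal.ofReal_mul (by positivity), ← pow_add, evalOneIntegral]

theorem integral_abs_pow (n : ℕ) : ∫ r in (-1 : ℝ)..1, |r| ^ n = 2 / (n + 1) := by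
  have hi : ∀ a b : ℝ, IntervalIntegrable (fun r : ℝ => |r| ^ n) volume a b := fun a b =>
    Continuous.intervalIntegrable (by fun_prop) _ _
  have h1 : ∫ r in (0 : ℝ)..1, |r| ^ n = 1 / (n + 1) := by
    rw [intervalIntegral.integral_congr (g := fun r => r ^ n), integral_pow]
    · simp
    · intro r hr
      rw [Set.uIcc_of_le zero_le_one] at hr
      simp only [abs_of_nonneg hr.1]
  have h2 : ∫ r in (-1 : ℝ)..0, |r| ^ n = 1 / (n + 1) := by
    have := intervalIntegral.integral_comp_neg (a := (0 : ℝ)) (b := 1) fun r => |r| ^ n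
    simp only [abs_neg, neg_zero] at this
    rw [← this, h1]
  rw [← intervalIntegral.integral_add_adjacent_intervals (hi (-1) 0) (hi 0 1), h1, h2]
  ring

theorem lintegral_abs_pow (n : ℕ) :
    ∫⁻ r in {r : ℝ | |r| ≤ 1}, ENNReal.ofReal (|r| ^ n) = ENNReal.ofReal (2 / (n + 1)) := by
  have hs : {r : ℝ | |r| ≤ 1} = Set.Icc (-1) 1 := by ext r; simp [abs_le]
  rw [← integral_abs_pow, intervalIntegral.integral_of_le (by norm_num), hs,
    ← integral_Icc_eq_integral_Ioc, ofReal_integral_eq_lintegral_ofReal]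
  · exact (Continuous.continuousOn (by fun_prop)).integrableOn_Icc
  · exact Filter.Eventually.of_forall fun r => by positivity

theorem volume_perronRegion_succ_eq (N : ℕ) :
    volume (perronRegion (N + 1)) =
      ENNReal.ofReal (4 / (((N + 1 : ℕ) : ℝ) * (((N + 1 : ℕ) : ℝ) + 1))) *
        evalOneIntegral {z | 1 ≤ ‖z‖} N := by
  -- For the exponent `e = N(N + 1)/2 + N` this turns the integral `2 / (e + 1)` of `|r| ^ e` into
  -- `4 / ((N + 1)(N + 2))`.
  have hs : ∀ n : ℕ, (2 : ℝ) * ((∑ i ∈ Finset.range n, (i + 1) + n : ℕ) + 1) =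
      (n + 1) * (n + 2) := fun n => by
    induction n with
    | zero => simp
    | succ n ih =>
      rw [Finset.sum_range_succ]
      push_cast at ih ⊢
      linarith
  have he : (2 : ℝ) / ((∑ i ∈ Finset.range N, (i + 1) + N : ℕ) + 1) =
      4 / (((N + 1 : ℕ) : ℝ) * (((N + 1 : ℕ) : ℝ) + 1)) := by
    have h := hs N
    rw [div_eq_div_iff (by positivity) (by positivity)]
    push_cast at h ⊢
    linarith
  rw [volume_perronRegion_succ, ← he, ← lintegral_abs_pow, ← lintegral_mul_const]
  · refine lintegral_congr_ae (ae_restrict_of_ae ?_)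
    filter_upwards [Measure.ae_ne volume (0 : ℝ)] with r hr
    exact setLIntegral_eval_scale N hr
  · exact (Continuous.measurable (by fun_prop)).ennreal_ofReal

theorem mainTheorem6 (N : ℕ) (hN : 1 ≤ N) :
    MeasurableSet (perronRegion N) ∧
    volume (perronRegion N) =
      ENNReal.ofReal (4 / ((N : ℝ) * ((N : ℝ) + 1)) * selbergC (N - 1) 1 1) ∧
    (Odd N → 4 / ((N : ℝ) * ((N : ℝ) + 1)) * selbergC (N - 1) 1 1 = constD N / (N : ℝ)) ∧
    (Even N → 4 / ((N : ℝ) * ((N : ℝ) + 1)) * selbergC (N - 1) 1 1 = constD N / ((N : ℝ) + 1)) := by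
  obtain ⟨M, rfl⟩ := Nat.exists_eq_add_of_le' hN
  rw [Nat.add_sub_cancel, selbergC_one_one]
  refine ⟨measurableSet_perronRegion_succ M, ?_, prod_evalOneFactor_of_even,
    prod_evalOneFactor_of_odd⟩
  rw [volume_perronRegion_succ_eq, ENNReal.ofReal_mul (by positivity),
    isExterior_one_le.evalOneIntegral_eq measurableSet_avoidRegion_one_le M,
    ENNReal.ofReal_prod_of_nonneg fun n _ => evalOneFactor_nonneg n]
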